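/- A Maker-Breaker game consists of a finite board $X$ and a family $\mathcal F$ of subsets of $X$, the winning sets. In the $(1:b)$ game Maker and Breaker alternately claim previously unclaimed elements of $X$, Maker moving first; Maker claims exactly one element per turn and Breaker exactly $b$ per turn (all remaining elements if fewer are left), until every element of $X$ is claimed. Maker wins if he has then claimed all elements of some winning set. For a finite simple graph $G$, the odd-cycle game $\mathcal{NC}_2(G)$ is the game with board $E(G)$ whose winning sets are the edge sets of the subgraphs $H\subseteq G$ that are not $2$-colorable (equivalently, that contain an odd cycle). For real $\ell\ge 0$, a graph $G$ with more than one vertex is called $\ell$-edge-connected if $G-F$ is connected for every set $F$ of fewer than $\ell$ edges. **Theorem.** For every integer $b\ge 2$ there exists an integer $n_0=n_0(b)$ such that the following holds. Let $G$ be a finite simple graph on $n\ge n_0$ vertices such that $G$ is $\left(10^4\log_2 n\cdot b^2(\log_2 b)^2\right)$-edge-connected and $\chi(G)\ge 3$. Then Maker has a winning strategy in the $(1:b)$ game $\mathcal{NC}_2(G)$. -/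

import Mathlib

/-- A Maker-Breaker game `(X, F)`: a finite board `X` and a family `F` of subsets of `X`, the
winning sets. -/
structure MakerBreakerGame (α : Type*) where
  board : Finset α
  winningSets : Set (Finset α)
  subset_board : ∀ F ∈ winningSets, F ⊆ board

namespace MakerBreakerGame

variable {α : Type*} [DecidableEq α]

/-- The record of the completed rounds, most recent round first. In a round `(S, T)` Maker, who
moves first, claimed the elements of `S`, and then Breaker claimed those of `T`. -/
abbrev History (α : Type*) := List (Finset α × Finset α)

/-- The set of all elements that Maker has claimed. -/
def makerSet (h : History α) : Finset α := h.foldr (fun r S => r.1 ∪ S) ∅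

/-- The set of all elements that Breaker has claimed. -/
def breakerSet (h : History α) : Finset α := h.foldr (fun r S => r.2 ∪ S) ∅

/-- The elements of the board that no player has claimed yet. -/
def free (Γ : MakerBreakerGame α) (h : History α) : Finset α :=
  Γ.board \ (makerSet h ∪ breakerSet h)

/-- `S` is a legal move of a player of bias `q` when `U` is the set of unclaimed elements: he claims
exactly `q` unclaimed elements, or all that are left if there are fewer than `q`. -/
def IsLegalMove (q : ℕ) (U S : Finset α) : Prop := S ⊆ U ∧ S.card = min q U.card

/-- A (deterministic) strategy of Maker: his next move, as a function of the game so far. -/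
abbrev Strategy (α : Type*) := History α → Finset α

/-- The histories that can arise, when it is Maker's turn, if Maker plays according to `σ` and
Breaker, of bias `b`, makes arbitrary legal moves. -/
inductive Arises (Γ : MakerBreakerGame α) (b : ℕ) (σ : Strategy α) : History α → Prop
  | start : Arises Γ b σ []
  | round (h : History α) (T : Finset α) : Arises Γ b σ h →
      IsLegalMove b (Γ.free h \ σ h) T → Arises Γ b σ ((σ h, T) :: h)

/-- `σ` is a winning strategy of Maker in the `(a : b)` game (with `a` and `b` positive, so that
every play ends): whatever Breaker does, the moves given by `σ` are legal, and when all elements of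
the board have been claimed, Maker has fully claimed a winning set. -/
def IsWinningStrategy (Γ : MakerBreakerGame α) (a b : ℕ) (σ : Strategy α) : Prop :=
  ∀ h, Γ.Arises b σ h →
    IsLegalMove a (Γ.free h) (σ h) ∧
      (Γ.free h = ∅ → ∃ F ∈ Γ.winningSets, F ⊆ makerSet h)

/-- Maker, as the first player, has a winning strategy in the `(a : b)` game. -/
def MakerHasWinningStrategy (Γ : MakerBreakerGame α) (a b : ℕ) : Prop :=
  ∃ σ : Strategy α, Γ.IsWinningStrategy a b σ

end MakerBreakerGame

/-- The non-`k`-colorability game on `E(G)`: the winning sets are the edge sets of the subgraphs of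
`G` that are not `k`-colorable. (Isolated vertices do not matter for this, so that it suffices to
take spanning subgraphs.) For `k = 2` this is the odd cycle game. -/
def nonColorabilityGame {V : Type*} (G : SimpleGraph V) [Fintype G.edgeSet] (k : ℕ) :
    MakerBreakerGame (Sym2 V) where
  board := G.edgeFinset
  winningSets := {F | ∃ H : SimpleGraph V, H ≤ G ∧ H.edgeSet = (F : Set (Sym2 V)) ∧ ¬ H.Colorable k}
  subset_board := by
    rintro F ⟨H, hHG, hF, -⟩ e he
    rw [SimpleGraph.mem_edgeFinset]
    exact SimpleGraph.edgeSet_mono hHG (hF ▸ Finset.mem_coe.mpr he)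

/-! A subgraph fails to be 2-colourable exactly when, for every 2-colouring `c` of the vertices, it
has an edge monochromatic under `c`. So Maker only has to hit every set `F_c` of monochromatic edges
of `G`. By Beck's criterion (`makerHasWinningStrategy_of_sum_lt_one`) this is possible if the sum of
`2^(-|F|/b)` over the distinct sets `F = F_c` is below 1. Let `F₀` be a smallest of these sets,
given by `c₀`. Any other comes from flipping `c₀` along a cut `δ`. Each edge of `δ` is monochromatic
before or after the flip, so `|δ| ≤ |F₀| + |F_c| ≤ 2|F_c|`, and the sum is at most `2^(-|F₀|/b)`
plus the sum of `2^(-|δ|/(2b))` over cuts (`sum_exp_monochromaticEdges_le`). As `G` is not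
2-colourable, `F₀` is nonempty and the first term is at most `1 - 1/(4b)`. A Karger-type estimate
(`sum_exp_cuts_le`), proved by contracting edges, bounds the cut sum by `1/n`, which is less than
`1/(4b)` once `n > 4b`. -/

namespace MakerBreakerGame

/-! ### Beck's potential argument for a biased game -/

section Potential

variable {α : Type*} [DecidableEq α]

/-- The weight of a set `F` of which Breaker holds the elements of `B`. -/
noncomputable def weight (t : ℝ) (B F : Finset α) : ℝ := Real.exp (-(t * (F \ B).card))

/-- The total weight of the sets of `𝓕` that Maker, holding `M`, has not hit yet. -/
noncomputable def potential (𝓕 : Finset (Finset α)) (t : ℝ) (M B : Finset α) : ℝ :=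
  ∑ F ∈ 𝓕 with Disjoint F M, weight t B F

/-- The total weight of the sets through `x` that Maker, holding `M`, has not hit yet. -/
noncomputable def danger (𝓕 : Finset (Finset α)) (t : ℝ) (M B : Finset α) (x : α) : ℝ :=
  ∑ F ∈ 𝓕 with Disjoint F M ∧ x ∈ F, weight t B F

lemma weight_nonneg (t : ℝ) (B F : Finset α) : 0 ≤ weight t B F := (Real.exp_pos _).le

/-- On `[0, 1]` the convex function `2^x` lies below its chord `1 + x`. -/
lemma exp_log_two_div_mul_le {b j : ℕ} (hb : 0 < b) (hj : j ≤ b) :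
    Real.exp (Real.log 2 / b * j) ≤ 1 + j / b := by
  have hb' : (0 : ℝ) < b := by exact_mod_cast hb
  have h1 : (j : ℝ) / b ≤ 1 := by rw [div_le_one hb']; exact_mod_cast hj
  have h0 : (0 : ℝ) ≤ (j : ℝ) / b := by positivity
  have h := convexOn_exp.2 (Set.mem_univ (0 : ℝ)) (Set.mem_univ (Real.log 2))
    (sub_nonneg.2 h1) h0 (by ring)
  simp only [smul_eq_mul, mul_zero, zero_add, Real.exp_zero, Real.exp_log (two_pos)] at h
  calc Real.exp (Real.log 2 / b * j) = Real.exp ((j : ℝ) / b * Real.log 2) := by ring_nf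
    _ ≤ _ := h
    _ = _ := by ring

/-- Being linear in `|F ∩ T|`, the bound lets the growth caused by a whole Breaker move be split
among the single elements of `T`. -/
lemma weight_union_le {b : ℕ} (hb : 0 < b) (B T F : Finset α) (hT : T.card ≤ b) :
    weight (Real.log 2 / b) (T ∪ B) F ≤
      weight (Real.log 2 / b) B F * (1 + (F ∩ T).card / b) := by
  have hb' : (0 : ℝ) < b := by exact_mod_cast hb
  have hc : (F \ B).card ≤ (F \ (T ∪ B)).card + (F ∩ T).card := by
    refine (Finset.card_le_card ?_).trans (Finset.card_union_le _ _)
    intro x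
    simp only [Finset.mem_sdiff, Finset.mem_union, Finset.mem_inter]
    tauto
  have hc' : ((F \ B).card : ℝ) ≤ (F \ (T ∪ B)).card + (F ∩ T).card := by exact_mod_cast hc
  have hj : (F ∩ T).card ≤ b := (Finset.card_le_card Finset.inter_subset_right).trans hT
  refine le_trans ?_ (mul_le_mul_of_nonneg_left (exp_log_two_div_mul_le hb hj)
    (weight_nonneg _ _ _))
  rw [weight, weight, ← Real.exp_add, Real.exp_le_exp]
  have : 0 ≤ Real.log 2 / b := div_nonneg (Real.log_nonneg one_le_two) hb'.le
  nlinarith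

/-- If Maker claims a most dangerous element, then the potential does not grow in the round. -/
lemma potential_round_le {b : ℕ} (hb : 0 < b) (𝓕 : Finset (Finset α)) (M B T : Finset α) (e : α)
    (hT : T.card ≤ b)
    (he : ∀ x ∈ T, danger 𝓕 (Real.log 2 / b) M B x ≤ danger 𝓕 (Real.log 2 / b) M B e) :
    potential 𝓕 (Real.log 2 / b) ({e} ∪ M) (T ∪ B) ≤ potential 𝓕 (Real.log 2 / b) M B := by
  set t := Real.log 2 / b with ht
  have hb' : (0 : ℝ) < b := by exact_mod_cast hb
  set 𝓖 := 𝓕.filter (fun F => Disjoint F M) with h𝓖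
  have hsplit : potential 𝓕 t M B =
      danger 𝓕 t M B e + ∑ F ∈ 𝓖 with e ∉ F, weight t B F := by
    rw [danger, ← Finset.filter_filter, ← h𝓖, Finset.sum_filter_add_sum_filter_not]
    rfl
  have hfil : 𝓕.filter (fun F => Disjoint F ({e} ∪ M)) = 𝓖.filter (fun F => e ∉ F) := by
    ext F
    simp only [h𝓖, Finset.mem_filter, Finset.disjoint_union_right, Finset.disjoint_singleton_right]
    tauto
  -- Double counting: Breaker's gain is at most `1/b` times the dangers summed over `T`, hence at
  -- most the danger of `e`, which Maker has just removed.
  have hsum : ∑ F ∈ 𝓖 with e ∉ F, weight t B F * (F ∩ T).card ≤ b * danger 𝓕 t M B e := by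
    calc ∑ F ∈ 𝓖 with e ∉ F, weight t B F * (F ∩ T).card
        ≤ ∑ F ∈ 𝓖, weight t B F * (F ∩ T).card :=
          Finset.sum_le_sum_of_subset_of_nonneg (Finset.filter_subset _ _)
            fun F _ _ => mul_nonneg (weight_nonneg _ _ _) (Nat.cast_nonneg _)
      _ = ∑ F ∈ 𝓖, ∑ x ∈ T, if x ∈ F then weight t B F else 0 := by
          refine Finset.sum_congr rfl fun F _ => ?_
          rw [← Finset.sum_filter, Finset.sum_const, nsmul_eq_mul, Finset.filter_mem_eq_inter,
            Finset.inter_comm, mul_comm]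
      _ = ∑ x ∈ T, danger 𝓕 t M B x := by
          rw [Finset.sum_comm]
          refine Finset.sum_congr rfl fun x _ => ?_
          rw [danger, ← Finset.filter_filter, ← h𝓖]
          exact (Finset.sum_filter _ _).symm
      _ ≤ T.card • danger 𝓕 t M B e := Finset.sum_le_card_nsmul _ _ _ he
      _ ≤ b * danger 𝓕 t M B e := by
          rw [nsmul_eq_mul]
          exact mul_le_mul_of_nonneg_right (by exact_mod_cast hT)
            (Finset.sum_nonneg fun F _ => weight_nonneg _ _ _)
  calc potential 𝓕 t ({e} ∪ M) (T ∪ B)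
      = ∑ F ∈ 𝓖 with e ∉ F, weight t (T ∪ B) F := by rw [potential, hfil]
    _ ≤ ∑ F ∈ 𝓖 with e ∉ F, weight t B F * (1 + (F ∩ T).card / b) :=
        Finset.sum_le_sum fun F _ => weight_union_le hb B T F hT
    _ = ∑ F ∈ 𝓖 with e ∉ F, weight t B F +
          (∑ F ∈ 𝓖 with e ∉ F, weight t B F * (F ∩ T).card) / b := by
        rw [Finset.sum_div, ← Finset.sum_add_distrib]
        exact Finset.sum_congr rfl fun F _ => by ring
    _ ≤ ∑ F ∈ 𝓖 with e ∉ F, weight t B F + danger 𝓕 t M B e := by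
        gcongr
        rwa [div_le_iff₀' hb']
    _ = potential 𝓕 t M B := by rw [hsplit, add_comm]

open Classical in
/-- The strategy of claiming a most dangerous element. -/
noncomputable def greedyStrategy (Γ : MakerBreakerGame α) (𝓕 : Finset (Finset α)) (t : ℝ) :
    Strategy α := fun h =>
  if hne : (Γ.free h).Nonempty then
    {(Finset.exists_max_image (Γ.free h) (danger 𝓕 t (makerSet h) (breakerSet h)) hne).choose}
  else ∅

lemma greedyStrategy_of_nonempty (Γ : MakerBreakerGame α) (𝓕 : Finset (Finset α)) (t : ℝ)
    {h : History α} (hne : (Γ.free h).Nonempty) :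
    ∃ e ∈ Γ.free h, Γ.greedyStrategy 𝓕 t h = {e} ∧ ∀ x ∈ Γ.free h,
      danger 𝓕 t (makerSet h) (breakerSet h) x ≤ danger 𝓕 t (makerSet h) (breakerSet h) e := by
  have hs := (Finset.exists_max_image (Γ.free h)
    (danger 𝓕 t (makerSet h) (breakerSet h)) hne).choose_spec
  exact ⟨_, hs.1, by rw [greedyStrategy, dif_pos hne], hs.2⟩

lemma greedyStrategy_of_empty (Γ : MakerBreakerGame α) (𝓕 : Finset (Finset α)) (t : ℝ)
    {h : History α} (he : Γ.free h = ∅) : Γ.greedyStrategy 𝓕 t h = ∅ := by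
  rw [greedyStrategy, dif_neg (by simp [he])]

lemma potential_le_of_arises (Γ : MakerBreakerGame α) {b : ℕ} (hb : 0 < b)
    (𝓕 : Finset (Finset α)) {h : History α}
    (hh : Γ.Arises b (Γ.greedyStrategy 𝓕 (Real.log 2 / b)) h) :
    potential 𝓕 (Real.log 2 / b) (makerSet h) (breakerSet h) ≤
      potential 𝓕 (Real.log 2 / b) ∅ ∅ := by
  induction hh with
  | start => exact le_rfl
  | round h T _ hT ih =>
    refine le_trans ?_ ih
    have hM : makerSet ((Γ.greedyStrategy 𝓕 (Real.log 2 / b) h, T) :: h) =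
      Γ.greedyStrategy 𝓕 (Real.log 2 / b) h ∪ makerSet h := rfl
    have hB : breakerSet ((Γ.greedyStrategy 𝓕 (Real.log 2 / b) h, T) :: h) =
      T ∪ breakerSet h := rfl
    rw [hM, hB]
    rcases (Γ.free h).eq_empty_or_nonempty with he | hne
    · have hT0 : T = ∅ := by
        have := hT.1
        rw [he, Finset.empty_sdiff] at this
        exact Finset.subset_empty.1 this
      rw [greedyStrategy_of_empty _ _ _ he, hT0, Finset.empty_union, Finset.empty_union]
    · obtain ⟨e, -, heq, hmax⟩ := Γ.greedyStrategy_of_nonempty 𝓕 (Real.log 2 / b) hne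
      rw [heq]
      refine potential_round_le hb 𝓕 _ _ _ e (hT.2.trans_le (min_le_left _ _)) fun x hx => ?_
      exact hmax x (Finset.mem_sdiff.1 (hT.1 hx)).1

lemma makerSet_subset_board (Γ : MakerBreakerGame α) {b : ℕ} (𝓕 : Finset (Finset α)) (t : ℝ)
    {h : History α} (hh : Γ.Arises b (Γ.greedyStrategy 𝓕 t) h) : makerSet h ⊆ Γ.board := by
  induction hh with
  | start => exact Finset.empty_subset _
  | round h T _ hT ih =>
    refine Finset.union_subset ?_ ih
    change Γ.greedyStrategy 𝓕 t h ⊆ Γ.board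
    rcases (Γ.free h).eq_empty_or_nonempty with he | hne
    · rw [greedyStrategy_of_empty _ _ _ he]
      exact Finset.empty_subset _
    · obtain ⟨e, hef, heq, -⟩ := Γ.greedyStrategy_of_nonempty 𝓕 t hne
      rw [heq, Finset.singleton_subset_iff]
      exact (Finset.mem_sdiff.1 hef).1

/-- Beck's biased Erdős–Selfridge criterion, for the player of bias `1`: if the total weight of
`𝓕` is less than `1`, he can claim an element of each set of `𝓕`. -/
theorem makerHasWinningStrategy_of_sum_lt_one (Γ : MakerBreakerGame α) {b : ℕ} (hb : 0 < b)
    (𝓕 : Finset (Finset α)) (h𝓕 : ∀ F ∈ 𝓕, F ⊆ Γ.board)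
    (hsum : ∑ F ∈ 𝓕, Real.exp (-(Real.log 2 / b * F.card)) < 1)
    (hwin : ∀ S ⊆ Γ.board, (∀ F ∈ 𝓕, ¬ Disjoint F S) → S ∈ Γ.winningSets) :
    Γ.MakerHasWinningStrategy 1 b := by
  refine ⟨Γ.greedyStrategy 𝓕 (Real.log 2 / b), fun h hh => ⟨?_, fun hfree => ?_⟩⟩
  · rcases (Γ.free h).eq_empty_or_nonempty with he | hne
    · rw [greedyStrategy_of_empty _ _ _ he, he]
      exact ⟨Finset.empty_subset _, by simp⟩
    · obtain ⟨e, hef, heq, -⟩ := Γ.greedyStrategy_of_nonempty 𝓕 (Real.log 2 / b) hne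
      rw [heq]
      refine ⟨Finset.singleton_subset_iff.2 hef, ?_⟩
      rw [Finset.card_singleton, min_eq_left (Finset.card_pos.2 hne)]
  · refine ⟨makerSet h, hwin _ (Γ.makerSet_subset_board 𝓕 _ hh) fun F hF hd => ?_,
      Finset.Subset.refl _⟩
    have hpot := Γ.potential_le_of_arises hb 𝓕 hh
    have h0 : potential 𝓕 (Real.log 2 / b) ∅ ∅ < 1 := by
      simpa [potential, weight] using hsum
    -- On a full board an unhit set belongs entirely to Breaker, so it alone has weight 1, against a
    -- potential below 1.
    have hFB : F \ breakerSet h = ∅ := by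
      rw [Finset.sdiff_eq_empty_iff_subset]
      intro x hx
      have hx' := Finset.sdiff_eq_empty_iff_subset.1 hfree (h𝓕 F hF hx)
      exact (Finset.mem_union.1 hx').resolve_left (Finset.disjoint_left.1 hd hx)
    have h1 : weight (Real.log 2 / b) (breakerSet h) F ≤
        potential 𝓕 (Real.log 2 / b) (makerSet h) (breakerSet h) :=
      Finset.single_le_sum (f := weight (Real.log 2 / b) (breakerSet h))
        (fun G _ => weight_nonneg _ _ _) (Finset.mem_filter.2 ⟨hF, hd⟩)
    rw [weight, hFB] at h1
    simp only [Finset.card_empty, Nat.cast_zero, mul_zero, neg_zero, Real.exp_zero] at h1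
    linarith

end Potential

end MakerBreakerGame

/-! ### Weighted counting of cuts by contraction -/

section CutCounting

variable {V ι : Type*} [DecidableEq V]

/-- In the multigraph with edges `E`, joining `s i` and `t i`, the edges that are not monochromatic
under `c`. -/
def bichromatic (E : Finset ι) (s t : ι → V) (c : V → Bool) : Finset ι :=
  {i ∈ E | c (s i) ≠ c (t i)}

/-- The nonconstant two-colourings of the vertices, that is, the nontrivial cuts. -/
def nonconstant (V : Type*) [Fintype V] [DecidableEq V] : Finset (V → Bool) :=
  {c | ∃ u v, c u ≠ c v}

lemma mem_nonconstant [Fintype V] {c : V → Bool} : c ∈ nonconstant V ↔ ∃ u v, c u ≠ c v := by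
  simp [nonconstant]

/-- The map contracting `y` to `x`. -/
def contraction {x y : V} (hxy : x ≠ y) (v : V) : {v : V // v ≠ y} :=
  if hv : v = y then ⟨x, hxy⟩ else ⟨v, hv⟩

lemma contraction_comp {x y : V} (hxy : x ≠ y) {c : V → Bool} (hc : c x = c y) (v : V) :
    c (contraction hxy v) = c v := by
  unfold contraction
  split_ifs with hv
  · rw [hv, hc]
  · rfl

lemma contraction_surjective {x y : V} (hxy : x ≠ y) : Function.Surjective (contraction hxy) :=
  fun v => ⟨v, by simp [contraction, v.2]⟩

lemma bichromatic_contraction (E : Finset ι) (s t : ι → V) {x y : V} (hxy : x ≠ y)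
    (c : {v : V // v ≠ y} → Bool) :
    bichromatic E (contraction hxy ∘ s) (contraction hxy ∘ t) c =
      bichromatic E s t (c ∘ contraction hxy) := rfl

lemma bichromatic_subset_nonloops (E : Finset ι) (s t : ι → V) (c : V → Bool) :
    bichromatic E s t c ⊆ {i ∈ E | s i ≠ t i} :=
  Finset.monotone_filter_right _ fun i _ h h' => h (by rw [h'])

/-- The cuts avoiding a given nonloop are the cuts of the contracted multigraph. -/
lemma sum_exp_le_sum_contraction [Fintype V] (E : Finset ι) (s t : ι → V) {x y : V} (hxy : x ≠ y)
    (τ : ℝ) :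
    ∑ c ∈ nonconstant V with c x = c y, Real.exp (-(τ * (bichromatic E s t c).card)) ≤
      ∑ c ∈ nonconstant {v : V // v ≠ y}, Real.exp (-(τ *
        (bichromatic E (contraction hxy ∘ s) (contraction hxy ∘ t) c).card)) := by
  classical
  set r : (V → Bool) → {v : V // v ≠ y} → Bool := fun c v => c v with hr
  have hrc : ∀ c : V → Bool, c x = c y → r c ∘ contraction hxy = c := fun c hc =>
    funext fun v => contraction_comp hxy hc v
  have hinj : Set.InjOn r ({c ∈ nonconstant V | c x = c y} : Finset (V → Bool)) := by
    intro c hc c' hc' h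
    rw [Finset.mem_coe, Finset.mem_filter] at hc hc'
    rw [← hrc c hc.2, h, hrc c' hc'.2]
  set φ : ({v : V // v ≠ y} → Bool) → ℝ := fun c => Real.exp (-(τ *
    (bichromatic E (contraction hxy ∘ s) (contraction hxy ∘ t) c).card)) with hφ
  calc _ = ∑ c ∈ nonconstant V with c x = c y, φ (r c) := by
        refine Finset.sum_congr rfl fun c hc => ?_
        simp only [hφ]
        rw [bichromatic_contraction, hrc c (Finset.mem_filter.1 hc).2]
    _ = ∑ c ∈ ({c ∈ nonconstant V | c x = c y} : Finset (V → Bool)).image r, φ c :=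
        (Finset.sum_image hinj).symm
    _ ≤ _ := by
        refine Finset.sum_le_sum_of_subset_of_nonneg ?_ fun _ _ _ => (Real.exp_pos _).le
        intro c' hc'
        obtain ⟨c, hc, rfl⟩ := Finset.mem_image.1 hc'
        obtain ⟨hc1, hc2⟩ := Finset.mem_filter.1 hc
        obtain ⟨u, v, huv⟩ := mem_nonconstant.1 hc1
        refine mem_nonconstant.2 ⟨contraction hxy u, contraction hxy v, ?_⟩
        change c _ ≠ c _
        rwa [contraction_comp hxy hc2, contraction_comp hxy hc2]

/-- Handshake bound: if all nontrivial cuts have size at least `k`, there are at least `k|V|/2`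
nonloops. -/
lemma mul_card_le_two_mul_card_nonloops [Fintype V] [Nontrivial V] (E : Finset ι) (s t : ι → V)
    {k : ℝ} (hk : ∀ c ∈ nonconstant V, k ≤ (bichromatic E s t c).card) :
    k * Fintype.card V ≤ 2 * ({i ∈ E | s i ≠ t i} : Finset ι).card := by
  classical
  have h1 : ∀ v : V, k ≤ ∑ i ∈ E with s i ≠ t i,
      ((if s i = v then (1 : ℝ) else 0) + if t i = v then (1 : ℝ) else 0) := by
    intro v
    -- The cut isolating `v` has at least `k` edges; summed over all `v`, each nonloop is counted
    -- twice.
    obtain ⟨w, hw⟩ := exists_ne v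
    refine (hk (fun u => decide (u = v)) (mem_nonconstant.2 ⟨w, v, by simp [hw]⟩)).trans ?_
    rw [bichromatic, Finset.card_eq_sum_ones, Nat.cast_sum, Finset.sum_filter, Finset.sum_filter]
    refine Finset.sum_le_sum fun i _ => ?_
    by_cases h1 : s i = v <;> by_cases h2 : t i = v <;> simp [h1, h2]
    rw [if_neg (Ne.symm h2)]
  calc k * Fintype.card V = ∑ _v : V, k := by simp [mul_comm]
    _ ≤ ∑ v : V, ∑ i ∈ E with s i ≠ t i,
      ((if s i = v then (1 : ℝ) else 0) + if t i = v then (1 : ℝ) else 0) :=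
        Finset.sum_le_sum fun v _ => h1 v
    _ = _ := by
        rw [Finset.sum_comm]
        simp only [Finset.sum_add_distrib, Finset.sum_ite_eq, Finset.mem_univ, if_true,
          Finset.sum_const, nsmul_eq_mul, mul_one]
        ring

/-- Averaging over the contractions of all nonloops. -/
lemma sum_exp_mul_le [Fintype V] (E : Finset ι) (s t : ι → V) (τ B : ℝ)
    (hB : ∀ i ∈ E, s i ≠ t i → ∑ c ∈ nonconstant V with c (s i) = c (t i),
      Real.exp (-(τ * (bichromatic E s t c).card)) ≤ B) :
    ∑ c ∈ nonconstant V, Real.exp (-(τ * (bichromatic E s t c).card)) *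
      (({i ∈ E | s i ≠ t i} : Finset ι).card - (bichromatic E s t c).card) ≤
        ({i ∈ E | s i ≠ t i} : Finset ι).card * B := by
  classical
  set N : Finset ι := {i ∈ E | s i ≠ t i} with hN
  -- The cut of `c` survives the contraction of precisely those nonloops that do not cross it.
  calc _ = ∑ c ∈ nonconstant V, ∑ i ∈ N,
        if c (s i) = c (t i) then Real.exp (-(τ * (bichromatic E s t c).card)) else 0 := by
        refine Finset.sum_congr rfl fun c _ => ?_
        rw [← Finset.sum_filter, Finset.sum_const, nsmul_eq_mul, mul_comm]
        congr 1
        rw [← Nat.cast_sub (Finset.card_le_card (bichromatic_subset_nonloops E s t c)),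
          ← Finset.card_sdiff_of_subset (bichromatic_subset_nonloops E s t c)]
        congr 2
        ext i
        simp only [bichromatic, hN, Finset.mem_sdiff, Finset.mem_filter]
        tauto
    _ = ∑ i ∈ N, ∑ c ∈ nonconstant V with c (s i) = c (t i),
        Real.exp (-(τ * (bichromatic E s t c).card)) := by
        rw [Finset.sum_comm]
        exact Finset.sum_congr rfl fun i _ => (Finset.sum_filter _ _).symm
    _ ≤ N.card • B := Finset.sum_le_card_nsmul _ _ _ fun i hi =>
        hB i (Finset.mem_filter.1 hi).1 (Finset.mem_filter.1 hi).2
    _ = _ := nsmul_eq_mul _ _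

/-- By convexity `exp (-x)` lies below its chord on `[0, 1]`, whose slope is at most `-1/2` because
`exp (-1) ≤ 1/2`. -/
lemma exp_neg_two_mul_le {z : ℝ} (h0 : 0 ≤ z) (h1 : z ≤ 1 / 2) : Real.exp (-(2 * z)) ≤ 1 - z := by
  have h2 : Real.exp (-1) ≤ 1 / 2 := by
    rw [Real.exp_neg, inv_le_comm₀ (Real.exp_pos _) (by norm_num)]
    have := Real.add_one_le_exp (1 : ℝ)
    norm_num at this ⊢
    linarith
  have h := convexOn_exp.2 (Set.mem_univ (0 : ℝ)) (Set.mem_univ (-1 : ℝ))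
    (by linarith : 0 ≤ 1 - 2 * z) (by linarith : 0 ≤ 2 * z) (by ring)
  simp only [smul_eq_mul, mul_zero, zero_add, Real.exp_zero, mul_neg, mul_one] at h
  nlinarith

lemma card_subtype_ne_add_one [Fintype V] (y : V) :
    Fintype.card {v : V // v ≠ y} + 1 = Fintype.card V := by
  have : 0 < Fintype.card V := Fintype.card_pos_iff.2 ⟨y⟩
  rw [Fintype.card_subtype_compl, Fintype.card_subtype_eq]
  omega

/-- Weighted Karger bound: in a multigraph whose nontrivial cuts all have size at least `k`, the sum
of `exp (-τ |δ|)` over the nontrivial cuts `δ` is small once `τ k` is a large enough multiple of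
the logarithm of the number of vertices. -/
theorem sum_exp_cuts_le {V : Type*} {ι : Type*} [Fintype V] [DecidableEq V]
    (E : Finset ι) (s t : ι → V) {k M τ : ℝ} (hk0 : 0 < k) (hM : 1 ≤ M)
    (hk : ∀ c ∈ nonconstant V, k ≤ (bichromatic E s t c).card)
    (hτ : 4 * Real.log 2 + 4 * Real.log M + 4 * (harmonic (Fintype.card V) : ℝ) ≤ τ * k) :
    ∑ c ∈ nonconstant V, Real.exp (-(τ * (bichromatic E s t c).card)) ≤
      Fintype.card V * (M ^ 2)⁻¹ := by
  classical
  have hM0 : 0 < M := by linarith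
  obtain ⟨N, hN⟩ : ∃ N, Fintype.card V = N := ⟨_, rfl⟩
  induction N generalizing V τ with
  | zero =>
    have : IsEmpty V := Fintype.card_eq_zero_iff.1 hN
    have h : nonconstant V = ∅ := by
      rw [Finset.eq_empty_iff_forall_notMem]
      intro c hc
      obtain ⟨u, -⟩ := mem_nonconstant.1 hc
      exact this.elim u
    rw [h, Finset.sum_empty]
    positivity
  | succ N ih =>
    rcases subsingleton_or_nontrivial V with hV | hV
    · have h : nonconstant V = ∅ := by
        rw [Finset.eq_empty_iff_forall_notMem]
        intro c hc
        obtain ⟨u, v, huv⟩ := mem_nonconstant.1 hc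
        exact huv (by rw [Subsingleton.elim u v])
      rw [h, Finset.sum_empty]
      positivity
    have hN2 : 2 ≤ N + 1 := by rw [← hN]; exact Fintype.one_lt_card
    have hNr : (2 : ℝ) ≤ (N + 1 : ℕ) := by exact_mod_cast hN2
    rw [hN] at hτ ⊢
    set n : ℝ := ((N + 1 : ℕ) : ℝ) with hn
    have hn0 : 0 < n := by linarith
    have hhar : (harmonic (N + 1) : ℝ) = harmonic N + n⁻¹ := by
      rw [harmonic_succ]; push_cast; rw [hn]; push_cast; ring
    set δ : (V → Bool) → ℝ := fun c => (bichromatic E s t c).card with hδ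
    set L : Finset ι := {i ∈ E | s i ≠ t i} with hL
    have hLc : k * n ≤ 2 * L.card := by
      have := mul_card_le_two_mul_card_nonloops E s t hk
      rwa [hN] at this
    have hL0 : (0 : ℝ) < L.card := by
      have : 0 < k * n := by positivity
      linarith
    -- Contracting one of `n` vertices costs `4/n` in `τ * k`; over the whole induction these losses
    -- add up to the harmonic term of the hypothesis.
    set τ' : ℝ := τ - 4 / (n * k) with hτ'
    have hτ'k : 4 * Real.log 2 + 4 * Real.log M + 4 * (harmonic N : ℝ) ≤ τ' * k := by
      have : τ' * k = τ * k - 4 * n⁻¹ := by rw [hτ']; field_simp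
      rw [this]
      rw [hhar] at hτ
      linarith
    have hcontr : ∀ i ∈ E, s i ≠ t i → ∑ c ∈ nonconstant V with c (s i) = c (t i),
        Real.exp (-(τ' * (bichromatic E s t c).card)) ≤ N * (M ^ 2)⁻¹ := by
      intro i _ hi
      have hcard : Fintype.card {v : V // v ≠ t i} = N := by
        have := card_subtype_ne_add_one (t i)
        omega
      refine (sum_exp_le_sum_contraction E s t hi τ').trans ?_
      have := ih (V := {v : V // v ≠ t i}) (contraction hi ∘ s) (contraction hi ∘ t) (τ := τ')
        (fun c hc => ?_) (by rwa [hcard]) hcard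
      · rwa [hcard] at this
      · rw [bichromatic_contraction]
        refine hk _ (mem_nonconstant.2 ?_)
        obtain ⟨u, v, huv⟩ := mem_nonconstant.1 hc
        obtain ⟨u, rfl⟩ := contraction_surjective hi u
        obtain ⟨v, rfl⟩ := contraction_surjective hi v
        exact ⟨u, v, huv⟩
    have havg := sum_exp_mul_le E s t τ' _ hcontr
    -- Since there are at least `n * k / 2` nonloops, a small cut survives a random contraction with
    -- probability at least `1 - z`, where `z = 2 * δ c / (n * k) ≤ 1/2`. This is at least `exp
    -- (-2z)`, exactly the factor lost in passing from `τ'` to `τ`.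
    have hsmall : ∑ c ∈ nonconstant V with δ c ≤ n * k / 4, Real.exp (-(τ * δ c)) ≤
        N * (M ^ 2)⁻¹ := by
      refine le_of_mul_le_mul_left ?_ hL0
      refine le_trans ?_ havg
      rw [Finset.mul_sum]
      refine le_trans (Finset.sum_le_sum fun c hc => ?_)
        (Finset.sum_le_sum_of_subset_of_nonneg (Finset.filter_subset _ _) fun c _ _ => ?_)
      · have hc2 : δ c ≤ n * k / 4 := (Finset.mem_filter.1 hc).2
        have hδ0 : 0 ≤ δ c := Nat.cast_nonneg _
        set z := 2 * δ c / (n * k) with hz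
        have hz0 : 0 ≤ z := by positivity
        have hz1 : z ≤ 1 / 2 := by
          rw [hz, div_le_iff₀ (by positivity)]
          linarith
        have hzL : L.card * z ≥ δ c := by
          rw [hz, mul_div_assoc', ge_iff_le, le_div_iff₀ (by positivity)]
          nlinarith
        have hexp : Real.exp (-(τ * δ c)) = Real.exp (-(τ' * δ c)) * Real.exp (-(2 * z)) := by
          rw [← Real.exp_add, hτ', hz]
          congr 1
          field_simp
          ring
        rw [hexp, mul_left_comm]
        refine mul_le_mul_of_nonneg_left ?_ (Real.exp_pos _).le
        have := mul_le_mul_of_nonneg_left (exp_neg_two_mul_le hz0 hz1) hL0.le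
        change _ ≤ (L.card : ℝ) - δ c
        linarith
      · refine mul_nonneg (Real.exp_pos _).le (sub_nonneg.2 ?_)
        exact_mod_cast Finset.card_le_card (bichromatic_subset_nonloops E s t c)
    -- For large cuts the trivial count `2 ^ n` is enough: as `τ * k ≥ 4 * log (2 * M)`, each term
    -- is at most `(2 * M) ^ (-n)`. Finally `n ≥ 2` and `M ≥ 1` turn `M ^ (-n)` into `M ^ (-2)`.
    have hlarge : ∑ c ∈ nonconstant V with ¬ δ c ≤ n * k / 4, Real.exp (-(τ * δ c)) ≤
        (M ^ 2)⁻¹ := by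
      have hharm : (0 : ℝ) ≤ harmonic (N + 1) := by
        exact_mod_cast (harmonic_pos (Nat.succ_ne_zero N)).le
      have hlogM := Real.log_nonneg hM
      have hlog2 := Real.log_pos one_lt_two
      have hτ0 : 0 ≤ τ := by
        by_contra hneg
        have := mul_neg_of_neg_of_pos (not_le.1 hneg) hk0
        linarith
      have hterm : ∀ c ∈ ({c ∈ nonconstant V | ¬ δ c ≤ n * k / 4} : Finset (V → Bool)),
          Real.exp (-(τ * δ c)) ≤ ((2 : ℝ) ^ (N + 1))⁻¹ * (M ^ (N + 1))⁻¹ := by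
        intro c hc
        have hc2 := not_le.1 (Finset.mem_filter.1 hc).2
        have h1 : n * (Real.log 2 + Real.log M) ≤ τ * δ c := by
          have h2 : τ * (n * k / 4) ≤ τ * δ c := mul_le_mul_of_nonneg_left hc2.le hτ0
          nlinarith
        rw [← mul_inv, ← mul_pow, ← Real.exp_log (by positivity : 0 < 2 * M), ← Real.exp_nat_mul,
          ← Real.exp_neg, Real.exp_le_exp, Real.log_mul two_ne_zero hM0.ne']
        linarith
      refine (Finset.sum_le_card_nsmul _ _ _ hterm).trans ?_
      have hcard : (({c ∈ nonconstant V | ¬ δ c ≤ n * k / 4} : Finset (V → Bool)).card : ℝ) ≤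
          2 ^ (N + 1) := by
        have := Finset.card_le_univ ({c ∈ nonconstant V | ¬ δ c ≤ n * k / 4} : Finset (V → Bool))
        rw [Fintype.card_fun, Fintype.card_bool, hN] at this
        exact_mod_cast this
      rw [nsmul_eq_mul]
      calc _ ≤ (2 : ℝ) ^ (N + 1) * (((2 : ℝ) ^ (N + 1))⁻¹ * (M ^ (N + 1))⁻¹) := by gcongr
        _ = (M ^ (N + 1))⁻¹ := by rw [mul_inv_cancel_left₀ (by positivity)]
        _ ≤ (M ^ 2)⁻¹ := by gcongr
    rw [← Finset.sum_filter_add_sum_filter_not _ (fun c => δ c ≤ n * k / 4)]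
    calc _ ≤ N * (M ^ 2)⁻¹ + (M ^ 2)⁻¹ := add_le_add hsmall hlarge
      _ = n * (M ^ 2)⁻¹ := by rw [hn]; push_cast; ring

end CutCounting

/-! ### Monochromatic edge sets and cuts of a graph -/

section OddCycleGame

variable {V : Type*}

lemma Sym2.mk_out_fst_out_snd (e : Sym2 V) : s((Quot.out e).1, (Quot.out e).2) = e :=
  Quot.out_eq e

/-- `Quot.out` orients each edge arbitrarily, which turns `G` into a multigraph with endpoint maps;
symmetric relations do not see the choice. -/
lemma Sym2.rel_out_iff {r : V → V → Prop} (hr : ∀ u v, r u v → r v u) (u v : V) :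
    r (Quot.out s(u, v)).1 (Quot.out s(u, v)).2 ↔ r u v := by
  have h := Sym2.mk_out_fst_out_snd s(u, v)
  rw [Sym2.eq_iff] at h
  rcases h with ⟨h1, h2⟩ | ⟨h1, h2⟩ <;> rw [h1, h2]
  exact ⟨hr _ _, hr _ _⟩

namespace SimpleGraph

variable (G : SimpleGraph V) [Fintype G.edgeSet]

/-- The edges of `G` that are monochromatic under `c`. -/
noncomputable def monochromaticEdges (c : V → Bool) : Finset (Sym2 V) :=
  {e ∈ G.edgeFinset | c (Quot.out e).1 = c (Quot.out e).2}

/-- The edges of `G` that are not monochromatic under `c`. -/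
noncomputable def cutEdges (c : V → Bool) : Finset (Sym2 V) :=
  bichromatic G.edgeFinset (fun e => (Quot.out e).1) (fun e => (Quot.out e).2) c

lemma mk_mem_monochromaticEdges {c : V → Bool} {u v : V} :
    s(u, v) ∈ G.monochromaticEdges c ↔ G.Adj u v ∧ c u = c v := by
  rw [monochromaticEdges, Finset.mem_filter, mem_edgeFinset, mem_edgeSet,
    Sym2.rel_out_iff (r := fun x y => c x = c y) fun _ _ => Eq.symm]

lemma mk_mem_cutEdges {c : V → Bool} {u v : V} :
    s(u, v) ∈ G.cutEdges c ↔ G.Adj u v ∧ c u ≠ c v := by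
  rw [cutEdges, bichromatic, Finset.mem_filter, mem_edgeFinset, mem_edgeSet,
    Sym2.rel_out_iff (r := fun x y => c x ≠ c y) fun _ _ => Ne.symm]

lemma monochromaticEdges_nonempty (h : ¬ G.Colorable 2) (c : V → Bool) :
    (G.monochromaticEdges c).Nonempty := by
  rw [Finset.nonempty_iff_ne_empty]
  intro he
  refine h ?_
  have := (Coloring.mk c (G := G) fun {u v} huv hc => by
    have : s(u, v) ∈ G.monochromaticEdges c := G.mk_mem_monochromaticEdges.2 ⟨huv, hc⟩
    simp [he] at this).colorable
  simpa using this

/-- A set of edges of `G` meeting all sets of monochromatic edges is the edge set of a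
subgraph that is not bipartite. -/
lemma mem_winningSets_of_hits [DecidableEq V] {S : Finset (Sym2 V)} (hS : S ⊆ G.edgeFinset)
    (hits : ∀ c, ¬ Disjoint (G.monochromaticEdges c) S) :
    S ∈ (nonColorabilityGame G 2).winningSets := by
  have hmem : ∀ {u v}, s(u, v) ∈ S → G.Adj u v := fun h => by
    simpa using hS h
  refine ⟨fromEdgeSet (S : Set (Sym2 V)), ?_, ?_, ?_⟩
  · intro u v huv
    rw [fromEdgeSet_adj] at huv
    exact hmem (Finset.mem_coe.1 huv.1)
  · ext e
    induction e with
    | _ u v =>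
      rw [mem_edgeSet, fromEdgeSet_adj]
      exact ⟨And.left, fun h => ⟨h, (hmem (Finset.mem_coe.1 h)).ne⟩⟩
  · rintro ⟨col⟩
    obtain ⟨e, he, heS⟩ := Finset.not_disjoint_iff.1 (hits fun v => finTwoEquiv (col v))
    induction e with
    | _ u v =>
      obtain ⟨huv, hc⟩ := G.mk_mem_monochromaticEdges.1 he
      refine col.valid ?_ (finTwoEquiv.injective hc)
      rw [fromEdgeSet_adj]
      exact ⟨heS, huv.ne⟩

lemma IsEdgeConnected.le_card_cutEdges {k : ℕ} (h : G.IsEdgeConnected k) {c : V → Bool} {u v : V}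
    (huv : c u ≠ c v) : k ≤ (G.cutEdges c).card := by
  by_contra! hlt
  have hr := h u v (s := (G.cutEdges c : Set (Sym2 V)))
    (by rw [Set.encard_coe_eq_coe_finsetCard]; exact_mod_cast hlt)
  obtain ⟨p⟩ := hr
  refine huv ?_
  clear huv
  induction p with
  | nil => rfl
  | cons hadj _ ih =>
    refine Eq.trans ?_ ih
    rw [deleteEdges_adj] at hadj
    by_contra hne
    exact hadj.2 (Finset.mem_coe.2 (G.mk_mem_cutEdges.2 ⟨hadj.1, hne⟩))

/-- The edges across a cut are monochromatic before or after flipping one side of the cut. -/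
lemma card_cutEdges_le (c τ : V → Bool) :
    (G.cutEdges τ).card ≤ (G.monochromaticEdges (fun v => xor (c v) (τ v))).card +
      (G.monochromaticEdges c).card := by
  classical
  refine (Finset.card_le_card ?_).trans (Finset.card_union_le _ _)
  intro e he
  induction e with
  | _ u v =>
    obtain ⟨huv, hne⟩ := G.mk_mem_cutEdges.1 he
    rw [Finset.mem_union, mk_mem_monochromaticEdges, mk_mem_monochromaticEdges]
    revert hne
    cases c u <;> cases c v <;> cases τ u <;> cases τ v <;> simp [huv]

lemma monochromaticEdges_xor_of_const (c τ : V → Bool) (hτ : ∀ u v, τ u = τ v) :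
    G.monochromaticEdges (fun v => xor (c v) (τ v)) = G.monochromaticEdges c := by
  ext e
  induction e with
  | _ u v => simp only [mk_mem_monochromaticEdges, hτ u v, Bool.xor_left_inj]

/-- Every colouring is `c₀` flipped along some `τ`. Minimality of `c₀` gives each flipped set at
least half the size of the cut, whence the exponent `t / 2`. The sum runs over distinct sets: a
colouring and its complement give the same set, and counting the one of `c₀` twice could already
exceed 1. -/
lemma sum_exp_monochromaticEdges_le [Fintype V] [DecidableEq V] {t : ℝ} (ht : 0 ≤ t)
    (c₀ : V → Bool) (hmin : ∀ c, (G.monochromaticEdges c₀).card ≤ (G.monochromaticEdges c).card) :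
    ∑ F ∈ Finset.univ.image G.monochromaticEdges, Real.exp (-(t * F.card)) ≤
      Real.exp (-(t * (G.monochromaticEdges c₀).card)) +
        ∑ τ ∈ nonconstant V, Real.exp (-(t / 2 * (G.cutEdges τ).card)) := by
  set w : Finset (Sym2 V) → ℝ := fun F => Real.exp (-(t * F.card)) with hw
  have hw0 : ∀ F, 0 ≤ w F := fun F => (Real.exp_pos _).le
  set f : (V → Bool) → Finset (Sym2 V) := fun τ => G.monochromaticEdges fun v => xor (c₀ v) (τ v)
    with hf
  have hsub : Finset.univ.image G.monochromaticEdges ⊆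
      {G.monochromaticEdges c₀} ∪ (nonconstant V).image f := by
    intro F hF
    obtain ⟨c, -, rfl⟩ := Finset.mem_image.1 hF
    have hc : f (fun v => xor (c₀ v) (c v)) = G.monochromaticEdges c := by
      simp only [hf, ← Bool.xor_assoc, Bool.xor_self, Bool.false_xor]
    rw [← hc, Finset.mem_union, Finset.mem_singleton]
    -- A constant flip changes no monochromatic edge, so it leads back to the set of `c₀`.
    by_cases hn : (fun v => xor (c₀ v) (c v)) ∈ nonconstant V
    · exact Or.inr (Finset.mem_image_of_mem f hn)
    · refine Or.inl (G.monochromaticEdges_xor_of_const _ _ fun u v => ?_)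
      by_contra hne
      exact hn (mem_nonconstant.2 ⟨u, v, hne⟩)
  calc ∑ F ∈ Finset.univ.image G.monochromaticEdges, w F
      ≤ ∑ F ∈ {G.monochromaticEdges c₀} ∪ (nonconstant V).image f, w F :=
        Finset.sum_le_sum_of_subset_of_nonneg hsub fun F _ _ => hw0 F
    _ ≤ ∑ F ∈ {G.monochromaticEdges c₀}, w F + ∑ F ∈ (nonconstant V).image f, w F := by
        rw [← Finset.sum_union_inter]
        exact le_add_of_nonneg_right (Finset.sum_nonneg fun F _ => hw0 F)
    _ ≤ w (G.monochromaticEdges c₀) + ∑ τ ∈ nonconstant V, w (f τ) := by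
        rw [Finset.sum_singleton]
        gcongr
        exact Finset.sum_image_le_of_nonneg fun F _ => hw0 F
    _ ≤ _ := by
        refine add_le_add le_rfl (Finset.sum_le_sum fun τ _ => ?_)
        rw [hw, Real.exp_le_exp, neg_le_neg_iff]
        have h : (G.cutEdges τ).card ≤ 2 * (f τ).card := by
          have h1 := G.card_cutEdges_le c₀ τ
          have h2 := hmin fun v => xor (c₀ v) (τ v)
          simp only [hf]
          omega
        have h' : ((G.cutEdges τ).card : ℝ) ≤ 2 * (f τ).card := by exact_mod_cast h
        have := mul_le_mul_of_nonneg_left h' (div_nonneg ht two_pos.le)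
        linarith

end SimpleGraph

/-! ### Numerical estimates and the main theorem -/

lemma log_bound_le_mul_edge_connectivity {b n : ℕ} (hb : 2 ≤ b) (hn : 3 ≤ n) {k : ℝ}
    (hk : 10 ^ 4 * Real.logb 2 n * ((b : ℝ) ^ 2 * (Real.logb 2 b) ^ 2) ≤ k) :
    4 * Real.log 2 + 4 * Real.log n + 4 * (harmonic n : ℝ) ≤ Real.log 2 / b / 2 * k := by
  have hbr : (2 : ℝ) ≤ b := by exact_mod_cast hb
  have hnr : (3 : ℝ) ≤ n := by exact_mod_cast hn
  have hlog2 : 0 < Real.log 2 := Real.log_pos one_lt_two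
  have hlogn : 1 ≤ Real.log n := by
    rw [Real.le_log_iff_exp_le (by linarith)]
    exact Real.exp_one_lt_three.le.trans hnr
  have h2n : Real.log 2 ≤ Real.log n := Real.log_le_log two_pos (by linarith)
  have hb1 : 1 ≤ Real.logb 2 b := by
    rw [Real.le_logb_iff_rpow_le one_lt_two (by linarith), Real.rpow_one]
    exact hbr
  have hb2 : 1 ≤ b * Real.logb 2 b ^ 2 := by
    have : 1 ≤ Real.logb 2 b ^ 2 := one_le_pow₀ hb1
    nlinarith
  have hH := harmonic_le_one_add_log n
  -- The left side is at most `16 * log n`, as `harmonic n ≤ 1 + log n` and `log n ≥ 1`. The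
  -- argument needs only `k` of order `b * log n`; the remaining factor `b * (logb 2 b) ^ 2` is at
  -- least 1 and is dropped.
  calc _ ≤ 5000 * Real.log n * 1 := by linarith
    _ ≤ 5000 * Real.log n * (b * Real.logb 2 b ^ 2) := by gcongr
    _ = Real.log 2 / b / 2 *
        (10 ^ 4 * Real.logb 2 n * ((b : ℝ) ^ 2 * (Real.logb 2 b) ^ 2)) := by
        have : Real.logb 2 n = Real.log n / Real.log 2 := rfl
        rw [this]
        field_simp
        ring
    _ ≤ _ := by gcongr

end OddCycleGame

theorem theorem1p2 (b : ℕ) (hb : 2 ≤ b) :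
    ∃ n₀ : ℕ, ∀ (V : Type*) [Fintype V] [DecidableEq V] (G : SimpleGraph V) [DecidableRel G.Adj],
      n₀ ≤ Fintype.card V →
      G.IsEdgeConnected
        ⌈(10 ^ 4 * Real.logb 2 (Fintype.card V) * ((b : ℝ) ^ 2 * (Real.logb 2 b) ^ 2) : ℝ)⌉₊ →
      3 ≤ G.chromaticNumber →
      (nonColorabilityGame G 2).MakerHasWinningStrategy 1 b := by
  refine ⟨4 * b + 1, fun V _ _ G _ hn hG hχ => ?_⟩
  have hcol : ¬ G.Colorable 2 := fun h => absurd (hχ.trans h.chromaticNumber_le) (by decide)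
  have hbr : (2 : ℝ) ≤ b := by exact_mod_cast hb
  have hnr : (4 * b + 1 : ℝ) ≤ Fintype.card V := by exact_mod_cast hn
  have hlog2 := Real.log_two_gt_d9
  set x : ℝ := 10 ^ 4 * Real.logb 2 (Fintype.card V) * ((b : ℝ) ^ 2 * (Real.logb 2 b) ^ 2) with hx
  have hx0 : 0 < x := by
    have h1 : 0 < Real.logb 2 (Fintype.card V) := Real.logb_pos one_lt_two (by linarith)
    have h2 : 0 < Real.logb 2 b := Real.logb_pos one_lt_two (by linarith)
    positivity
  have hk0 : (0 : ℝ) < ⌈x⌉₊ := by exact_mod_cast Nat.ceil_pos.2 hx0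
  obtain ⟨c₀, -, hmin⟩ := Finset.exists_min_image Finset.univ
    (fun c => (G.monochromaticEdges c).card) ⟨fun _ : V => true, Finset.mem_univ _⟩
  -- Taking `M = n` makes the bound `n * (n ^ 2)⁻¹ = 1 / n`.
  have hcuts := sum_exp_cuts_le G.edgeFinset (fun e => (Quot.out e).1) (fun e => (Quot.out e).2)
    hk0 (M := Fintype.card V) (τ := Real.log 2 / b / 2) (by linarith)
    (fun c hc => by
      obtain ⟨u, v, huv⟩ := mem_nonconstant.1 hc
      exact_mod_cast hG.le_card_cutEdges G huv)
    (log_bound_le_mul_edge_connectivity hb (by omega) (Nat.le_ceil x))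
  have hrest : (Fintype.card V : ℝ) * ((Fintype.card V : ℝ) ^ 2)⁻¹ < 1 / (4 * b) := by
    rw [sq, mul_inv, mul_inv_cancel_left₀ (by linarith), ← one_div]
    exact one_div_lt_one_div_of_lt (by linarith) (by linarith)
  have hfirst : Real.exp (-(Real.log 2 / b * (G.monochromaticEdges c₀).card)) ≤
      1 - 1 / (4 * b) := by
    have h1 : (1 : ℝ) ≤ (G.monochromaticEdges c₀).card := by
      exact_mod_cast Finset.card_pos.2 (G.monochromaticEdges_nonempty hcol c₀)
    -- With this `z`, `2 * z = (1 / 2) / b ≤ log 2 / b`, and the minimal set has at least one edge.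
    refine le_trans ?_ (exp_neg_two_mul_le (z := 1 / (4 * b)) (by positivity) ?_)
    · rw [Real.exp_le_exp, neg_le_neg_iff]
      calc 2 * (1 / (4 * (b : ℝ))) = (1 / 2) / b := by field_simp; norm_num
        _ ≤ Real.log 2 / b := by gcongr; linarith
        _ ≤ _ := le_mul_of_one_le_right (by positivity) h1
    · exact one_div_le_one_div_of_le two_pos (by linarith)
  refine MakerBreakerGame.makerHasWinningStrategy_of_sum_lt_one _ (by omega)
    (Finset.univ.image G.monochromaticEdges) ?_ ?_ ?_
  · intro F hF
    obtain ⟨c, -, rfl⟩ := Finset.mem_image.1 hF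
    exact Finset.filter_subset _ _
  · refine (G.sum_exp_monochromaticEdges_le (by positivity) c₀
      fun c => hmin c (Finset.mem_univ c)).trans_lt ?_
    have h : ∑ τ ∈ nonconstant V, Real.exp (-(Real.log 2 / b / 2 * (G.cutEdges τ).card)) ≤
      (Fintype.card V : ℝ) * ((Fintype.card V : ℝ) ^ 2)⁻¹ := hcuts
    linarith
  · intro S hS hits
    exact G.mem_winningSets_of_hits hS fun c =>
      hits _ (Finset.mem_image_of_mem _ (Finset.mem_univ c))
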